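/- Let $P, Q \subset \mathbb{R}^2$ be Lebesgue measurable sets of finite measure whose boundaries have Lebesgue measure zero, and let $m$ denote Lebesgue measure. For $\tau,\rho>0$ put $$P_\tau=\{(\tau x_1,x_2) : (x_1,x_2)\in P\},\qquad Q_\rho=\{(x_1,\rho x_2) : (x_1,x_2)\in Q\}.$$ Let $\mathcal{F}$ be the Fourier transform on $L^2(\mathbb{R}^2)=L^2(\mathbb{R}^2;\mathbb{C})$ normalized by $\mathcal{F}f(u)=\int_{\mathbb{R}^2} f(x)e^{-ix\cdot u}\,dx$, and for a measurable set $S\subset\mathbb{R}^2$ let $\mathcal{T}_S f=\mathbf{1}_S f$ and $\mathcal{B}_S f=\mathcal{F}^{-1}\mathbf{1}_S\mathcal{F}f$ be the orthogonal projections of $L^2(\mathbb{R}^2)$ onto the functions supported in $S$ and onto the functions whose Fourier transform is supported in $S$, respectively. Let $0<\varepsilon<1$. Then for all $\tau,\rho>0$ the number $N_{\tau,\rho}(\varepsilon)$ of eigenvalues, counted with multiplicity, of $\mathcal{T}_{P_\tau}\mathcal{B}_{Q_\rho}\mathcal{T}_{P_\tau}$ that are not smaller than $\varepsilon$ is finite,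 and $$N_{\tau,\rho}(\varepsilon)=(2\pi)^{-2}\,m(P)\,m(Q)\,\tau\rho+o(\tau\rho)\qquad\text{as }\tau,\rho\to\infty,$$ where $\tau$ and $\rho$ tend to infinity independently of each other. -/

import Mathlib

open MeasureTheory Filter Asymptotics
open scoped FourierTransform ENNReal

noncomputable section

/-- The plane `ℝ²` with its Euclidean structure and Lebesgue measure. -/
abbrev Plane : Type := EuclideanSpace ℝ (Fin 2)

/-- The Hilbert space `L²(ℝ²)` of complex-valued square-integrable functions. -/
abbrev L2Plane : Type := Lp (α := Plane) ℂ 2 volume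

/-- `P_τ = {(τ x₁, x₂) : x ∈ P}`. -/
def scaleFst (τ : ℝ) (P : Set Plane) : Set Plane :=
  (fun x : Plane => !₂[τ * x 0, x 1]) '' P

/-- `Q_ρ = {(x₁, ρ x₂) : x ∈ Q}`. -/
def scaleSnd (ρ : ℝ) (Q : Set Plane) : Set Plane :=
  (fun x : Plane => !₂[x 0, ρ * x 1]) '' Q

/-- The image of a Lebesgue measurable set under a linear endomorphism of the plane is Lebesgue
measurable. -/
theorem nullMeasurableSet_image_linear (L : Plane →ₗ[ℝ] Plane) {S : Set Plane}
    (hS : NullMeasurableSet S volume) : NullMeasurableSet (L '' S) volume := by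
  by_cases hL : LinearMap.det L = 0
  · apply NullMeasurableSet.of_null
    rw [Measure.addHaar_image_linearMap, hL]
    simp
  · let e := L.equivOfDetNeZero hL
    have hL' : ∀ x, L x = e x := fun _ => rfl
    have h1 : L '' S = e.symm ⁻¹' S := by
      rw [← e.image_eq_preimage_symm]
      rfl
    rw [h1]
    apply hS.preimage
    refine ⟨(LinearMap.continuous_of_finiteDimensional
      (e.symm : Plane →ₗ[ℝ] Plane)).measurable, ?_⟩
    have h2 := Measure.map_linearMap_addHaar_eq_smul_addHaar (volume : Measure Plane)
      (f := (e.symm : Plane →ₗ[ℝ] Plane)) (LinearEquiv.isUnit_det' e.symm).ne_zero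
    have h3 : Measure.map (fun x => e.symm x) (volume : Measure Plane) = _ := h2
    rw [h3]
    exact Measure.smul_absolutelyContinuous

theorem nullMeasurableSet_scaleFst (τ : ℝ) {P : Set Plane} (hP : NullMeasurableSet P volume) :
    NullMeasurableSet (scaleFst τ P) volume :=
  nullMeasurableSet_image_linear
    { toFun := fun x => !₂[τ * x 0, x 1]
      map_add' := fun x y => by ext i; fin_cases i <;> simp [mul_add]
      map_smul' := fun c x => by ext i; fin_cases i <;> simp [mul_left_comm] } hP

theorem nullMeasurableSet_scaleSnd (ρ : ℝ) {Q : Set Plane} (hQ : NullMeasurableSet Q volume) :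
    NullMeasurableSet (scaleSnd ρ Q) volume :=
  nullMeasurableSet_image_linear
    { toFun := fun x => !₂[x 0, ρ * x 1]
      map_add' := fun x y => by ext i; fin_cases i <;> simp [mul_add]
      map_smul' := fun c x => by ext i; fin_cases i <;> simp [mul_left_comm] } hQ

theorem memLp_indicator_of_null {S : Set Plane} (hS : NullMeasurableSet S volume) (f : L2Plane) :
    MemLp (S.indicator f) 2 volume :=
  ⟨(Lp.memLp f).1.indicator₀ hS, (eLpNorm_indicator_le _).trans_lt (Lp.memLp f).2⟩

/-- The operator `T_S f = 1_S f` on `L²(ℝ²)`, for a Lebesgue measurable set `S`. -/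
def spaceLimit (S : Set Plane) (hS : NullMeasurableSet S volume) : L2Plane →L[ℂ] L2Plane :=
  LinearMap.mkContinuous
    { toFun := fun f => (memLp_indicator_of_null hS f).toLp (S.indicator f)
      map_add' := fun f g => by
        rw [← MemLp.toLp_add]
        apply MemLp.toLp_congr
        filter_upwards [Lp.coeFn_add f g] with x hx
        simp only [Pi.add_apply] at hx ⊢
        by_cases h : x ∈ S
        · simpa only [Set.indicator_of_mem h] using hx
        · simp [Set.indicator_of_notMem h]
      map_smul' := fun c f => by
        rw [RingHom.id_apply, ← MemLp.toLp_const_smul]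
        apply MemLp.toLp_congr
        filter_upwards [Lp.coeFn_smul c f] with x hx
        simp only [Pi.smul_apply] at hx ⊢
        by_cases h : x ∈ S
        · simpa only [Set.indicator_of_mem h] using hx
        · simp [Set.indicator_of_notMem h] }
    1 (fun f => by
      rw [one_mul]
      apply Lp.norm_le_norm_of_ae_le
      filter_upwards [MemLp.coeFn_toLp (memLp_indicator_of_null hS f)] with x hx
      simp only [LinearMap.coe_mk, AddHom.coe_mk]
      rw [hx]
      exact norm_indicator_le_norm_self _ _)

/-- `{w : 2π w ∈ S}`, the set `S` of angular frequencies expressed in ordinary frequencies. -/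
def ordinaryFreq (S : Set Plane) : Set Plane := {w | (2 * Real.pi) • w ∈ S}

theorem nullMeasurableSet_ordinaryFreq {S : Set Plane} (hS : NullMeasurableSet S volume) :
    NullMeasurableSet (ordinaryFreq S) volume := by
  have hpi : (2 * Real.pi) ≠ 0 := by positivity
  have h : ordinaryFreq S = ((2 * Real.pi)⁻¹ • LinearMap.id : Plane →ₗ[ℝ] Plane) '' S := by
    ext w
    constructor
    · intro hw
      exact ⟨(2 * Real.pi) • w, hw, by
        simp only [LinearMap.smul_apply, LinearMap.id_coe, id_eq]
        rw [smul_smul, inv_mul_cancel₀ hpi, one_smul]⟩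
    · rintro ⟨x, hx, rfl⟩
      change (2 * Real.pi) • ((2 * Real.pi)⁻¹ • x) ∈ S
      rwa [smul_smul, mul_inv_cancel₀ hpi, one_smul]
  rw [h]
  exact nullMeasurableSet_image_linear _ hS

/-- The operator `B_S = F⁻¹ 1_S F` on `L²(ℝ²)`, for a Lebesgue measurable set `S`, where
`(F f)(u) = ∫ f(x) exp(-i x·u) dx`. Mathlib's (unitary) Fourier transform on `L²` is
`(𝓕 f)(w) = ∫ f(x) exp(-2πi x·w) dx`, so `(F f)(u) = (𝓕 f)(u / 2π)`, and multiplying `F f` by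
the indicator of `S` amounts to multiplying `𝓕 f` by the indicator of `{w : 2π w ∈ S}`. -/
def bandLimit (S : Set Plane) (hS : NullMeasurableSet S volume) : L2Plane →L[ℂ] L2Plane :=
  ((Lp.fourierTransformₗᵢ Plane ℂ).symm.toContinuousLinearEquiv : L2Plane →L[ℂ] L2Plane) ∘L
    spaceLimit (ordinaryFreq S) (nullMeasurableSet_ordinaryFreq hS) ∘L
    ((Lp.fourierTransformₗᵢ Plane ℂ).toContinuousLinearEquiv : L2Plane →L[ℂ] L2Plane)

/-- The operator `T_P B_Q T_P`. -/
def limitingOp (P Q : Set Plane) (hP : NullMeasurableSet P volume)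
    (hQ : NullMeasurableSet Q volume) : L2Plane →L[ℂ] L2Plane :=
  spaceLimit P hP ∘L bandLimit Q hQ ∘L spaceLimit P hP

/-- The eigenspace of a bounded operator on `L²(ℝ²)` for a real number `μ`. -/
def realEigenspace (T : L2Plane →L[ℂ] L2Plane) (μ : ℝ) : Submodule ℂ L2Plane :=
  Module.End.eigenspace (T : L2Plane →ₗ[ℂ] L2Plane) (μ : ℂ)

/-- `T` has only finitely many real eigenvalues `≥ ε`, counted with multiplicity: finitely many
distinct ones, each of finite multiplicity. -/
def FinitelyManyEigenvaluesGE (T : L2Plane →L[ℂ] L2Plane) (ε : ℝ) : Prop :=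
  {μ : ℝ | ε ≤ μ ∧ realEigenspace T μ ≠ ⊥}.Finite ∧
    ∀ μ : ℝ, ε ≤ μ → FiniteDimensional ℂ (realEigenspace T μ)

/-- The number of real eigenvalues `≥ ε` of `T`, counted with multiplicity (meaningful when
`FinitelyManyEigenvaluesGE T ε` holds). -/
def eigenvalueCount (T : L2Plane →L[ℂ] L2Plane) (ε : ℝ) : ℕ :=
  ∑ᶠ (μ : ℝ) (_ : ε ≤ μ), Module.finrank ℂ (realEigenspace T μ)

end

/-! Let `R` be the set `Q` in ordinary frequencies and `X = 1_R 𝓕 1_P`. Then `A = T_P B_Q T_P`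
equals `X* X`, so `0 ≤ A ≤ 1`. Both `Tr A = ‖X‖²_HS = m(P) m(R)` and `Tr A² = ‖A‖²_HS = ∫_P ∫_P |K(y
- x)|²`, with `K = 𝓕⁻ 1_R`, are computed from pointwise representers (`tsum_enorm_spaceLimit_sq`).
In particular `A` is compact.

For an eigenvalue `λ ∈ [0, 1]`, the difference between `1_{λ ≥ ε}` and `λ` is at most a constant
`C(ε)` times `λ - λ²`. Summing over an eigenbasis, the count differs from `Tr A` by at most `C(ε)
(Tr A - Tr A²)` (`eigenvalueCount_sub_trace_le`).

For the scaled sets `Tr A = τρ m(P) m(R)`, and a change of variables gives `Tr A² = τρ ∫_P ∫ 1_P(x +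
(z₁/τ, z₂/ρ)) |K(z)|² dz dx`. The shift vanishes as `τ, ρ → ∞`, however the two are related. As the
boundary of `P` is null, `P` may be replaced by its interior, where the indicator is eventually 1.
Dominated convergence and Plancherel, `∫ |K|² = m(R)`, then give `Tr A - Tr A² = o(τρ)`
(`tendsto_lintegral_kernel`). -/

/-! ### Hilbert bases and Hilbert–Schmidt operators -/

/-- Orthonormal vectors are `√2` apart, so balls of radius `1/2` around them are disjoint.
Countability is what later permits exchanging sums over a basis with integrals. -/
theorem Orthonormal.countable_of_separable {𝕜 E ι : Type*} [RCLike 𝕜] [NormedAddCommGroup E]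
    [InnerProductSpace 𝕜 E] [TopologicalSpace.SeparableSpace E] {v : ι → E}
    (hv : Orthonormal 𝕜 v) : Countable ι := by
  have hd : Pairwise fun i j => Disjoint (Metric.ball (v i) (1 / 2)) (Metric.ball (v j) (1 / 2)) := by
    intro i j hij
    apply Metric.ball_disjoint_ball
    have h : ‖v i - v j‖ * ‖v i - v j‖ = 2 := by
      rw [@norm_sub_mul_self 𝕜, hv.1 i, hv.1 j, hv.2 hij]
      norm_num
    rw [dist_eq_norm]
    nlinarith [norm_nonneg (v i - v j)]
  exact Pairwise.countable_of_isOpen_disjoint hd (fun _ => Metric.isOpen_ball)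
    (fun i => ⟨v i, Metric.mem_ball_self (by norm_num)⟩)

theorem HilbertBasis.hasSum_norm_inner_sq {𝕜 E ι : Type*} [RCLike 𝕜] [NormedAddCommGroup E]
    [InnerProductSpace 𝕜 E] (b : HilbertBasis ι 𝕜 E) (x : E) :
    HasSum (fun i => ‖inner 𝕜 (b i) x‖ ^ 2) (‖x‖ ^ 2) := by
  have h := RCLike.hasSum_re 𝕜 (b.hasSum_inner_mul_inner x x)
  convert h using 1
  · ext i
    rw [← inner_conj_symm x (b i), RCLike.conj_mul]
    norm_cast
  · rw [inner_self_eq_norm_sq]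

theorem HilbertBasis.tsum_enorm_inner_sq {𝕜 E ι : Type*} [RCLike 𝕜] [NormedAddCommGroup E]
    [InnerProductSpace 𝕜 E] (b : HilbertBasis ι 𝕜 E) (x : E) :
    ∑' i, ‖inner 𝕜 (b i) x‖ₑ ^ 2 = ‖x‖ₑ ^ 2 := by
  have h := b.hasSum_norm_inner_sq x
  have h1 := ENNReal.ofReal_tsum_of_nonneg (fun i => sq_nonneg _) h.summable
  rw [h.tsum_eq] at h1
  simp only [ENNReal.ofReal_pow (norm_nonneg _), ofReal_norm] at h1
  exact h1.symm

/-- A Hilbert–Schmidt operator is compact. -/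
theorem ContinuousLinearMap.isCompactOperator_of_summable_norm_sq {𝕜 E F ι : Type*} [RCLike 𝕜]
    [NormedAddCommGroup E] [InnerProductSpace 𝕜 E] [NormedAddCommGroup F] [NormedSpace 𝕜 F]
    [CompleteSpace F] (b : HilbertBasis ι 𝕜 E) (T : E →L[𝕜] F)
    (hT : Summable fun i => ‖T (b i)‖ ^ 2) : IsCompactOperator T := by
  classical
  -- Finite-rank truncations of `T`. They converge in operator norm, and compact operators form a
  -- closed set.
  let G : Finset ι → E →L[𝕜] F := fun s => ∑ i ∈ s, (innerSL 𝕜 (b i)).smulRight (T (b i))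
  have hG : ∀ s, G s ∈ {f : E →L[𝕜] F | IsCompactOperator f} := by
    intro s
    have : ∀ i, IsCompactOperator ((innerSL 𝕜 (b i)).smulRight (T (b i))) := by
      intro i
      have h1 : IsCompactOperator (innerSL 𝕜 (b i)) := by
        refine ⟨Metric.closedBall 0 1, isCompact_closedBall _ _, ?_⟩
        exact (innerSL 𝕜 (b i)).continuous.continuousAt (by
          rw [map_zero]; exact Metric.closedBall_mem_nhds _ one_pos)
      exact h1.clm_comp ((ContinuousLinearMap.id 𝕜 𝕜).smulRight (T (b i)))
    exact Submodule.sum_mem (compactOperator (RingHom.id 𝕜) E F) fun i _ => this i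
  have hcl : IsClosed {f : E →L[𝕜] F | IsCompactOperator f} := isClosed_setOfPred_isCompactOperator
  change T ∈ {f : E →L[𝕜] F | IsCompactOperator f}
  refine hcl.mem_of_tendsto (f := G) (b := atTop) ?_ (Eventually.of_forall hG)
  rw [Metric.tendsto_atTop]
  intro ε hε
  obtain ⟨s, hs⟩ := summable_iff_vanishing_norm.mp hT ((ε / 2) ^ 2) (by positivity)
  refine ⟨s, fun t hst => ?_⟩
  rw [dist_eq_norm, norm_sub_rev]
  refine lt_of_le_of_lt (ContinuousLinearMap.opNorm_le_bound _ (half_pos hε).le fun x => ?_)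
    (half_lt_self hε)
  -- The tail at `x` is a limit of finite sums over `u \ t`, each bounded by Cauchy–Schwarz and
  -- Bessel.
  have hlim : Tendsto (fun u => ‖G u x - G t x‖) atTop (nhds ‖(T - G t) x‖) := by
    have h1 := (b.hasSum_repr x).mapL T
    have h2 : Tendsto (fun u => G u x) atTop (nhds (T x)) := by
      simp only [map_smul, b.repr_apply_apply] at h1
      rw [HasSum, SummationFilter.unconditional_filter] at h1
      simpa [G] using h1
    simpa using (h2.sub_const (G t x)).norm
  refine le_of_tendsto hlim ?_
  filter_upwards [eventually_ge_atTop t] with u hu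
  have h1 : G u x - G t x = ∑ i ∈ u \ t, inner 𝕜 (b i) x • T (b i) := by
    rw [Finset.sum_sdiff_eq_sub hu]
    simp [G]
  rw [h1]
  have h2 : ∑ i ∈ u \ t, ‖T (b i)‖ ^ 2 ≤ (ε / 2) ^ 2 := by
    have h3 := hs (u \ t) (Finset.disjoint_left.mpr fun i hi hi' =>
      (Finset.mem_sdiff.mp hi).2 (hst hi'))
    exact (le_abs_self _).trans h3.le
  have h4 : ∑ i ∈ u \ t, ‖inner 𝕜 (b i) x‖ ^ 2 ≤ ‖x‖ ^ 2 :=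
    b.orthonormal.sum_inner_products_le x
  calc ‖∑ i ∈ u \ t, inner 𝕜 (b i) x • T (b i)‖
      ≤ ∑ i ∈ u \ t, ‖inner 𝕜 (b i) x‖ * ‖T (b i)‖ :=
        (norm_sum_le _ _).trans (Finset.sum_le_sum fun i _ => norm_smul_le _ _)
    _ ≤ ε / 2 * ‖x‖ := by
        refine abs_le_of_sq_le_sq' ?_ (by positivity) |>.2
        refine (Finset.sum_mul_sq_le_sq_mul_sq _ _ _).trans ?_
        rw [mul_pow, mul_comm]
        gcongr

/-! ### Spectral decomposition and eigenvalue counting -/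

/-- An eigenbasis of a compact self-adjoint operator, indexed by the eigenvalues and bases of the
eigenspaces. -/
theorem exists_hilbertBasis_eigenspaces {E : Type*} [NormedAddCommGroup E]
    [InnerProductSpace ℂ E] [CompleteSpace E] {A : E →L[ℂ] E} (hA : IsCompactOperator A)
    (hs : (A : E →ₗ[ℂ] E).IsSymmetric) :
    ∃ (w : (μ : ℂ) → Set (Module.End.eigenspace (A : E →ₗ[ℂ] E) μ))
      (_ : ∀ μ, Nonempty (HilbertBasis (w μ) ℂ (Module.End.eigenspace (A : E →ₗ[ℂ] E) μ)))
      (b : HilbertBasis (Σ μ : ℂ, w μ) ℂ E), ∀ i, A (b i) = i.1 • b i := by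
  have hc : ∀ μ : ℂ, CompleteSpace (Module.End.eigenspace (A : E →ₗ[ℂ] E) μ) := by
    intro μ
    have : IsClosed (Module.End.eigenspace (A : E →ₗ[ℂ] E) μ : Set E) := by
      have h : (Module.End.eigenspace (A : E →ₗ[ℂ] E) μ : Set E) = {x | A x = μ • x} := by
        ext x
        simp
      rw [h]
      exact isClosed_eq A.continuous (continuous_const_smul μ)
    exact this.completeSpace_coe
  choose w c hw using fun μ => exists_hilbertBasis ℂ (Module.End.eigenspace (A : E →ₗ[ℂ] E) μ)
  have ho := hs.orthogonalFamily_eigenspaces.orthonormal_sigma_orthonormal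
    (fun μ => (c μ).orthonormal)
  have hsp : (Submodule.span ℂ (Set.range fun a : Σ μ : ℂ, w μ =>
      (Module.End.eigenspace (A : E →ₗ[ℂ] E) a.1).subtypeₗᵢ (c a.1 a.2)))ᗮ = ⊥ := by
    rw [eq_bot_iff, ← ContinuousLinearMap.orthogonalComplement_iSup_eigenspaces_eq_bot hA hs,
      ← Submodule.iInf_orthogonal]
    intro x hx
    rw [Submodule.mem_iInf]
    intro μ
    rw [Submodule.mem_orthogonal] at hx ⊢
    -- Expand `u` in the chosen basis of its eigenspace: `x` is orthogonal to every term, hence to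
    -- `u`.
    intro u hu
    have h1 := (c μ).hasSum_repr ⟨u, hu⟩
    have h2 := (h1.mapL (Submodule.subtypeL _)).mapL (innerSLFlip ℂ x)
    refine h2.unique ?_
    convert hasSum_zero with i
    have h3 := hx (c μ i) (Submodule.subset_span ⟨⟨μ, i⟩, rfl⟩)
    simp [h3]
  refine ⟨w, fun μ => ⟨c μ⟩, HilbertBasis.mkOfOrthogonalEqBot ho hsp, fun i => ?_⟩
  rw [HilbertBasis.coe_mkOfOrthogonalEqBot]
  exact Module.End.mem_eigenspace_iff.mp (c i.1 i.2).2

theorem HilbertBasis.finiteDimensional_and_finrank_eq {𝕜 E ι : Type*} [RCLike 𝕜]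
    [NormedAddCommGroup E] [InnerProductSpace 𝕜 E] [Finite ι] (b : HilbertBasis ι 𝕜 E) :
    FiniteDimensional 𝕜 E ∧ Module.finrank 𝕜 E = Nat.card ι := by
  have := Fintype.ofFinite ι
  exact ⟨b.toOrthonormalBasis.toBasis.finiteDimensional_of_finite,
    Module.finrank_eq_nat_card_basis b.toOrthonormalBasis.toBasis⟩

/-- For a positive compact contraction `A`, the number of eigenvalues `≥ ε` differs from the trace
of `A` by at most a multiple of `Tr A - Tr A²`. -/
theorem eigenvalueCount_sub_trace_le {A : L2Plane →L[ℂ] L2Plane} (hA : IsCompactOperator A)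
    (hs : (A : L2Plane →ₗ[ℂ] L2Plane).IsSymmetric)
    (hpos : ∀ x, 0 ≤ (inner ℂ x (A x)).re) (hle : ∀ x, (inner ℂ x (A x)).re ≤ ‖x‖ ^ 2)
    {t₁ t₂ : ℝ}
    (h₁ : ∀ (ι : Type) [Countable ι] (b : HilbertBasis ι ℂ L2Plane),
      HasSum (fun i => (inner ℂ (b i) (A (b i))).re) t₁)
    (h₂ : ∀ (ι : Type) [Countable ι] (b : HilbertBasis ι ℂ L2Plane),
      HasSum (fun i => ‖A (b i)‖ ^ 2) t₂)
    {ε : ℝ} (hε0 : 0 < ε) (hε1 : ε < 1) :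
    FinitelyManyEigenvaluesGE A ε ∧
      |(eigenvalueCount A ε : ℝ) - t₁| ≤ (1 / ε + 1 / (1 - ε)) * (t₁ - t₂) := by
  classical
  have : Fact ((2 : ℝ≥0∞) ≠ ∞) := ⟨ENNReal.ofNat_ne_top⟩
  obtain ⟨w, hw, b, hb⟩ := exists_hilbertBasis_eigenspaces hA hs
  have hcount : Countable (Σ μ : ℂ, w μ) := b.orthonormal.countable_of_separable
  have hnorm : ∀ i, ‖b i‖ = 1 := b.orthonormal.1
  have hin : ∀ i, inner ℂ (b i) (A (b i)) = i.1 := by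
    intro i
    rw [hb, inner_smul_right, inner_self_eq_norm_sq_to_K, hnorm]
    simp
  have him : ∀ i : Σ μ : ℂ, w μ, ((i.1.re : ℝ) : ℂ) = i.1 := by
    intro i
    apply Complex.conj_eq_iff_re.mp
    refine hs.conj_eigenvalue_eq_self (Module.End.hasEigenvalue_of_hasEigenvector (x := b i) ⟨?_, ?_⟩)
    · exact Module.End.mem_eigenspace_iff.mpr (hb i)
    · intro h
      simpa [h] using hnorm i
  have hl0 : ∀ i : Σ μ : ℂ, w μ, 0 ≤ i.1.re := fun i => by simpa [hin] using hpos (b i)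
  have hl1 : ∀ i : Σ μ : ℂ, w μ, i.1.re ≤ 1 := fun i => by simpa [hin, hnorm] using hle (b i)
  -- The traces are evaluated in the eigenbasis, which is only available here; this is why `h₁` and
  -- `h₂` range over all countable bases.
  have hs1 : HasSum (fun i : Σ μ : ℂ, w μ => i.1.re) t₁ := by simpa [hin] using h₁ _ b
  have hs2 : HasSum (fun i : Σ μ : ℂ, w μ => i.1.re ^ 2) t₂ := by
    convert h₂ _ b using 2 with i
    rw [hb, norm_smul, hnorm, mul_one, ← him i, Complex.norm_real, Real.norm_eq_abs, sq_abs,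
      Complex.ofReal_re]
  have hfin : {i : Σ μ : ℂ, w μ | ε ≤ i.1.re}.Finite := by
    have h := hs1.summable.tendsto_cofinite_zero.eventually (gt_mem_nhds hε0)
    rw [Filter.eventually_cofinite] at h
    simpa using h
  have hwfin : ∀ μ : ℝ, ε ≤ μ → Finite (w (μ : ℂ)) := by
    intro μ hμ
    have : Finite {i : Σ μ : ℂ, w μ | ε ≤ i.1.re} := hfin
    refine Finite.of_injective
      (fun x : w (μ : ℂ) => (⟨⟨(μ : ℂ), x⟩, by simpa using hμ⟩ :
        {i : Σ μ : ℂ, w μ | ε ≤ i.1.re})) ?_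
    intro x y hxy
    simpa using hxy
  have hrank : ∀ μ : ℝ, ε ≤ μ → FiniteDimensional ℂ (realEigenspace A μ) ∧
      Module.finrank ℂ (realEigenspace A μ) = Nat.card (w (μ : ℂ)) := by
    intro μ hμ
    have := hwfin μ hμ
    exact HilbertBasis.finiteDimensional_and_finrank_eq (hw (μ : ℂ)).some
  let F : Finset ℝ := hfin.toFinset.image fun i => i.1.re
  have hF : ∀ μ : ℝ, ε ≤ μ → Nonempty (w (μ : ℂ)) → μ ∈ F := by
    rintro μ hμ ⟨x⟩
    exact Finset.mem_image.mpr ⟨⟨(μ : ℂ), x⟩, by simpa using hμ, by simp⟩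
  have hFle : ∀ μ ∈ F, ε ≤ μ := by
    intro μ hμ
    obtain ⟨i, hi, rfl⟩ := Finset.mem_image.mp hμ
    simpa using hi
  have hcard : eigenvalueCount A ε = hfin.toFinset.card := by
    unfold eigenvalueCount
    rw [finsum_eq_sum_of_support_subset (s := F)]
    -- Group the basis indices by eigenvalue. Eigenvalues being real (`him`), the fibre over `μ` is
    -- a copy of `w μ`, whose size is the multiplicity.
    · rw [Finset.card_eq_sum_card_fiberwise (f := fun i => i.1.re) (t := F)
        (fun i hi => Finset.mem_image_of_mem _ hi)]
      refine Finset.sum_congr rfl fun μ hμ => ?_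
      rw [finsum_eq_if, if_pos (hFle μ hμ), (hrank μ (hFle μ hμ)).2]
      have := hwfin μ (hFle μ hμ)
      have := Fintype.ofFinite (w (μ : ℂ))
      rw [Nat.card_eq_fintype_card, ← Finset.card_univ,
        ← Finset.card_map (Function.Embedding.sigmaMk (β := fun μ : ℂ => w μ) (μ : ℂ))]
      congr 1
      ext ⟨ν, x⟩
      simp only [Finset.mem_map, Finset.mem_univ, true_and, Finset.mem_filter,
        Set.Finite.mem_toFinset, Set.mem_ofPred_eq]
      constructor
      · rintro ⟨y, hy⟩
        have h' : (μ : ℂ) = ν := congrArg Sigma.fst hy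
        subst h'
        simpa using hFle μ hμ
      · rintro ⟨-, h⟩
        have h' : (μ : ℂ) = ν := by
          rw [← h]
          exact him ⟨ν, x⟩
        subst h'
        exact ⟨x, rfl⟩
    · intro μ hμ
      rw [Function.mem_support, finsum_eq_if] at hμ
      by_cases h : ε ≤ μ
      · rw [if_pos h, (hrank μ h).2] at hμ
        exact hF μ h (Nat.card_ne_zero.mp hμ).1
      · simp [h] at hμ
  refine ⟨⟨F.finite_toSet.subset ?_, fun μ hμ => (hrank μ hμ).1⟩, ?_⟩
  · rintro μ ⟨hμ, hne⟩
    refine hF μ hμ ?_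
    have := (hrank μ hμ).1
    have h : Module.finrank ℂ (realEigenspace A μ) ≠ 0 := by
      rwa [Ne, Submodule.finrank_eq_zero]
    rw [(hrank μ hμ).2] at h
    exact (Nat.card_ne_zero.mp h).1
  · have hN : HasSum (fun i : Σ μ : ℂ, w μ => if ε ≤ i.1.re then (1 : ℝ) else 0)
        (eigenvalueCount A ε : ℝ) := by
      rw [hcard]
      convert hasSum_sum_of_ne_finset_zero (s := hfin.toFinset) (L := .unconditional _) ?_ using 1
      · rw [Finset.sum_congr rfl (g := fun _ => (1 : ℝ))]
        · simp
        · intro i hi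
          simpa using hi
      · intro i hi
        simpa using hi
    have hd := hN.sub hs1
    have hc := (hs1.sub hs2).mul_left (1 / ε + 1 / (1 - ε))
    have hε1' : 0 < 1 - ε := by linarith
    -- If `λ ≥ ε`, then `1 - λ ≤ λ(1 - λ)/ε`; if `λ < ε`, then `λ ≤ λ(1 - λ)/(1 - ε)`. The constant
    -- is the sum of the two factors.
    have key : ∀ i : Σ μ : ℂ, w μ, |(if ε ≤ i.1.re then (1 : ℝ) else 0) - i.1.re| ≤
        (1 / ε + 1 / (1 - ε)) * (i.1.re - i.1.re ^ 2) := by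
      intro i
      have h0 := hl0 i
      have h1 := hl1 i
      have e1 : 0 ≤ 1 / (1 - ε) := by positivity
      have e0 : 0 ≤ 1 / ε := by positivity
      have hq : 0 ≤ i.1.re - i.1.re ^ 2 := by nlinarith
      split_ifs with h
      · rw [abs_of_nonneg (by linarith)]
        have : 1 - i.1.re ≤ 1 / ε * (i.1.re - i.1.re ^ 2) := by
          rw [one_div, ← div_eq_inv_mul, le_div_iff₀ hε0]
          nlinarith
        nlinarith
      · rw [zero_sub, abs_neg, abs_of_nonneg h0]
        have : i.1.re ≤ 1 / (1 - ε) * (i.1.re - i.1.re ^ 2) := by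
          rw [one_div, ← div_eq_inv_mul, le_div_iff₀ hε1']
          nlinarith
        nlinarith
    rw [abs_le]
    exact ⟨hasSum_le (fun i => (abs_le.mp (key i)).1) hc.neg hd,
      hasSum_le (fun i => (abs_le.mp (key i)).2) hd hc⟩

/-! ### Fourier transform on `L²` versus Fourier integral -/

/-- The Fourier transform on `L²` agrees with the Fourier integral on integrable functions. -/
theorem MeasureTheory.Lp.fourier_coeFn_ae_eq {V : Type*} [NormedAddCommGroup V]
    [InnerProductSpace ℝ V] [FiniteDimensional ℝ V] [MeasurableSpace V] [BorelSpace V]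
    (f : Lp (α := V) ℂ 2 volume) (hf : Integrable f) :
    (𝓕 f : Lp (α := V) ℂ 2 volume) =ᵐ[volume] 𝓕 (f : V → ℂ) := by
  have hc : Continuous (𝓕 (f : V → ℂ)) := VectorFourier.fourierIntegral_continuous
    Real.continuous_fourierChar continuous_inner hf
  refine ae_eq_of_integral_contDiff_smul_eq
    ((Lp.memLp (𝓕 f)).locallyIntegrable (by norm_num)) hc.locallyIntegrable fun g hg hgc => ?_
  have hg₁ : HasCompactSupport (Complex.ofRealCLM ∘ g) := hgc.comp_left rfl
  have hg₂ : ContDiff ℝ ((⊤ : ℕ∞) : WithTop ℕ∞) (Complex.ofRealCLM ∘ g) := by fun_prop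
  let φ : SchwartzMap V ℂ := hg₁.toSchwartzMap hg₂
  have h1 : ∀ h : V → ℂ, ∫ x, g x • h x = ∫ x, φ x • h x := fun h =>
    integral_congr_ae (Eventually.of_forall fun x => by
      change g x • h x = (g x : ℂ) • h x
      rw [Complex.coe_smul])
  rw [h1, h1]
  -- Both sides move the transform onto the test function: by duality of tempered distributions for
  -- `L²`, by Fubini for the integral.
  have h2 := DFunLike.congr_fun (Lp.fourier_toTemperedDistribution_eq f) φ
  rw [TemperedDistribution.fourier_apply, Lp.toTemperedDistribution_apply,
    Lp.toTemperedDistribution_apply] at h2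
  rw [← h2]
  have h3 := VectorFourier.integral_bilin_fourierIntegral_eq_flip (ContinuousLinearMap.lsmul ℂ ℂ)
    (L := innerₗ V) Real.continuous_fourierChar continuous_inner (φ.integrable (μ := volume)) hf
  rw [flip_innerₗ] at h3
  exact h3

/-- The inverse Fourier transform on `L²` agrees with the inverse Fourier integral on integrable
functions. -/
theorem MeasureTheory.Lp.fourierInv_coeFn_ae_eq {V : Type*} [NormedAddCommGroup V]
    [InnerProductSpace ℝ V] [FiniteDimensional ℝ V] [MeasurableSpace V] [BorelSpace V]
    (f : Lp (α := V) ℂ 2 volume) (hf : Integrable f) :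
    (𝓕⁻ f : Lp (α := V) ℂ 2 volume) =ᵐ[volume] 𝓕⁻ (f : V → ℂ) := by
  have hL : Continuous fun p : V × V => (-innerₗ V) p.1 p.2 := continuous_inner.neg
  have hc : Continuous (𝓕⁻ (f : V → ℂ)) := VectorFourier.fourierIntegral_continuous
    Real.continuous_fourierChar hL hf
  refine ae_eq_of_integral_contDiff_smul_eq
    ((Lp.memLp (𝓕⁻ f)).locallyIntegrable (by norm_num)) hc.locallyIntegrable fun g hg hgc => ?_
  have hg₁ : HasCompactSupport (Complex.ofRealCLM ∘ g) := hgc.comp_left rfl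
  have hg₂ : ContDiff ℝ ((⊤ : ℕ∞) : WithTop ℕ∞) (Complex.ofRealCLM ∘ g) := by fun_prop
  let φ : SchwartzMap V ℂ := hg₁.toSchwartzMap hg₂
  have h1 : ∀ h : V → ℂ, ∫ x, g x • h x = ∫ x, φ x • h x := fun h =>
    integral_congr_ae (Eventually.of_forall fun x => by
      change g x • h x = (g x : ℂ) • h x
      rw [Complex.coe_smul])
  rw [h1, h1]
  have h2 := DFunLike.congr_fun (Lp.fourierInv_toTemperedDistribution_eq f) φ
  rw [TemperedDistribution.fourierInv_apply, Lp.toTemperedDistribution_apply,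
    Lp.toTemperedDistribution_apply] at h2
  rw [← h2]
  have h3 := VectorFourier.integral_bilin_fourierIntegral_eq_flip (ContinuousLinearMap.lsmul ℂ ℂ)
    (L := -innerₗ V) Real.continuous_fourierChar hL (φ.integrable (μ := volume)) hf
  have hflip : (-innerₗ V).flip = -innerₗ V := by
    ext x y
    simp [real_inner_comm]
  rw [hflip] at h3
  rw [SchwartzMap.fourierInv_coe]
  exact h3

theorem MeasureTheory.L2.enorm_sq_eq_lintegral {α E : Type*} [MeasurableSpace α] {μ : Measure α}
    [NormedAddCommGroup E] (f : Lp E 2 μ) : ‖f‖ₑ ^ 2 = ∫⁻ x, ‖f x‖ₑ ^ 2 ∂μ := by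
  rw [Lp.enorm_def, eLpNorm_eq_lintegral_rpow_enorm_toReal (by norm_num) (by norm_num),
    ← ENNReal.rpow_natCast, ← ENNReal.rpow_mul]
  simp

/-! ### Cutoffs, plane waves and integral kernels -/

section SpaceLimit

variable {S : Set Plane} (hS : NullMeasurableSet S volume)

theorem spaceLimit_coeFn (f : L2Plane) : spaceLimit S hS f =ᵐ[volume] S.indicator f :=
  MemLp.coeFn_toLp (memLp_indicator_of_null hS f)

theorem integrable_spaceLimit (hfin : volume S ≠ ∞) (f : L2Plane) :
    Integrable (spaceLimit S hS f) := by
  refine Integrable.congr ?_ (spaceLimit_coeFn hS f).symm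
  have : IsFiniteMeasure (volume.restrict S) := ⟨by simpa using hfin.lt_top⟩
  have h : IntegrableOn f S := ((Lp.memLp f).restrict S).integrable (by norm_num)
  exact h.integrable_indicator₀ hS

theorem inner_spaceLimit_left (f g : L2Plane) :
    inner ℂ (spaceLimit S hS f) g = inner ℂ f (spaceLimit S hS g) := by
  rw [L2.inner_def, L2.inner_def]
  refine integral_congr_ae ?_
  filter_upwards [spaceLimit_coeFn hS f, spaceLimit_coeFn hS g] with x h1 h2
  rw [h1, h2]
  by_cases h : x ∈ S <;> simp [h]

theorem spaceLimit_spaceLimit (f : L2Plane) :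
    spaceLimit S hS (spaceLimit S hS f) = spaceLimit S hS f := by
  refine Lp.ext ?_
  filter_upwards [spaceLimit_coeFn hS f, spaceLimit_coeFn hS (spaceLimit S hS f)] with x h1 h2
  rw [h2]
  by_cases h : x ∈ S <;> simp [h, h1]

theorem norm_spaceLimit_le (f : L2Plane) : ‖spaceLimit S hS f‖ ≤ ‖f‖ := by
  refine Lp.norm_le_norm_of_ae_le ?_
  filter_upwards [spaceLimit_coeFn hS f] with x h1
  rw [h1]
  exact norm_indicator_le_norm_self _ _

theorem enorm_spaceLimit_sq (f : L2Plane) :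
    ‖spaceLimit S hS f‖ₑ ^ 2 = ∫⁻ x in S, ‖f x‖ₑ ^ 2 := by
  rw [L2.enorm_sq_eq_lintegral, ← lintegral_indicator₀ hS]
  refine lintegral_congr_ae ?_
  filter_upwards [spaceLimit_coeFn hS f] with x h1
  rw [h1]
  by_cases h : x ∈ S <;> simp [h]

/-- The Hilbert–Schmidt norm of an integral operator restricted to `S`. -/
theorem tsum_enorm_spaceLimit_sq {ι : Type*} [Countable ι] (b : HilbertBasis ι ℂ L2Plane)
    (T : L2Plane → L2Plane) (k : Plane → L2Plane)
    (hT : ∀ f, T f =ᵐ[volume] fun w => inner ℂ (k w) f) :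
    ∑' i, ‖spaceLimit S hS (T (b i))‖ₑ ^ 2 = ∫⁻ w in S, ‖k w‖ₑ ^ 2 := by
  have h1 : ∀ i, ‖spaceLimit S hS (T (b i))‖ₑ ^ 2 = ∫⁻ w in S, ‖inner ℂ (b i) (k w)‖ₑ ^ 2 := by
    intro i
    rw [enorm_spaceLimit_sq]
    refine lintegral_congr_ae (ae_restrict_of_ae ?_)
    filter_upwards [hT (b i)] with w hw
    rw [hw, ← ofReal_norm, ← ofReal_norm, norm_inner_symm]
  -- Nothing is assumed about measurability of `k`; it is inherited from `T (b i)`. Tonelli and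
  -- Parseval for `k w` then conclude.
  have h2 : ∀ i, AEMeasurable (fun w => ‖inner ℂ (b i) (k w)‖ₑ ^ 2) (volume.restrict S) := by
    intro i
    refine AEMeasurable.restrict ?_
    refine AEMeasurable.congr ((Lp.aestronglyMeasurable (T (b i))).enorm.pow_const 2) ?_
    filter_upwards [hT (b i)] with w hw
    rw [hw, ← ofReal_norm, ← ofReal_norm, norm_inner_symm]
  simp_rw [h1]
  rw [← lintegral_tsum h2]
  simp_rw [b.tsum_enorm_inner_sq]

end SpaceLimit

section Wave

variable {S : Set Plane} (hS : NullMeasurableSet S volume) (hfin : volume S ≠ ∞)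
include hS hfin

theorem memLp_indicator_wave (w : Plane) :
    MemLp (S.indicator fun x : Plane => (Real.fourierChar (inner ℝ x w) : ℂ)) 2 volume := by
  have : IsFiniteMeasure (volume.restrict (toMeasurable volume S)) :=
    ⟨by simpa [measure_toMeasurable] using hfin.lt_top⟩
  -- `S` is only null measurable, so it is traded for its measurable hull.
  refine MemLp.ae_eq (indicator_ae_eq_of_ae_eq_set hS.toMeasurable_ae_eq) ?_
  rw [memLp_indicator_iff_restrict (measurableSet_toMeasurable _ _)]
  refine MemLp.of_bound (C := 1) ?_ (Eventually.of_forall fun x => (Circle.norm_coe _).le)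
  exact (Continuous.aestronglyMeasurable
    (continuous_induced_dom.comp (Real.continuous_fourierChar.comp (by fun_prop))))

/-- The plane wave of frequency `w`, cut off to the set `S`. -/
noncomputable def wave (w : Plane) : L2Plane := (memLp_indicator_wave hS hfin w).toLp _

theorem wave_coeFn (w : Plane) : wave hS hfin w =ᵐ[volume]
    S.indicator fun x : Plane => (Real.fourierChar (inner ℝ x w) : ℂ) :=
  MemLp.coeFn_toLp _

theorem enorm_wave_sq (w : Plane) : ‖wave hS hfin w‖ₑ ^ 2 = volume S := by
  rw [L2.enorm_sq_eq_lintegral, ← setLIntegral_one, ← lintegral_indicator₀ hS]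
  refine lintegral_congr_ae ?_
  filter_upwards [wave_coeFn hS hfin w] with x hx
  rw [hx]
  by_cases h : x ∈ S
  · have h1 : ‖(Real.fourierChar (inner ℝ x w) : ℂ)‖ₑ = 1 := by
      rw [← ofReal_norm, Circle.norm_coe, ENNReal.ofReal_one]
    simp [h, h1]
  · simp [h]

/-- The inner product conjugates its first argument, turning the wave into the Fourier kernel. Thus
waves are the representers needed for Hilbert–Schmidt norms. -/
theorem inner_wave (f : L2Plane) (w : Plane) :
    inner ℂ (wave hS hfin w) f = 𝓕 (spaceLimit S hS f : Plane → ℂ) w := by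
  rw [L2.inner_def, Real.fourier_eq]
  refine integral_congr_ae ?_
  filter_upwards [spaceLimit_coeFn hS f, wave_coeFn hS hfin w] with x h1 h2
  rw [h1, h2]
  by_cases h : x ∈ S
  · simp [h, Circle.smul_def, AddChar.map_neg_eq_inv, mul_comm]
  · simp [h]

theorem fourier_spaceLimit_ae_eq (f : L2Plane) :
    (𝓕 (spaceLimit S hS f) : L2Plane) =ᵐ[volume] fun w => inner ℂ (wave hS hfin w) f := by
  filter_upwards [Lp.fourier_coeFn_ae_eq _ (integrable_spaceLimit hS hfin f)] with w hw
  rw [hw, inner_wave]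

theorem fourierInv_spaceLimit_ae_eq (f : L2Plane) :
    (𝓕⁻ (spaceLimit S hS f) : L2Plane) =ᵐ[volume] fun w => inner ℂ (wave hS hfin (-w)) f := by
  filter_upwards [Lp.fourierInv_coeFn_ae_eq _ (integrable_spaceLimit hS hfin f)] with w hw
  rw [hw, inner_wave, Real.fourierInv_eq_fourier_neg]

/-- Modulation becomes translation under the inverse transform. -/
theorem fourierInv_wave_ae_eq (w : Plane) :
    (𝓕⁻ (wave hS hfin w) : L2Plane) =ᵐ[volume] fun y => 𝓕⁻ (S.indicator fun _ => (1 : ℂ)) (y + w) := by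
  have hint : Integrable (wave hS hfin w) := by
    refine Integrable.congr ?_ (wave_coeFn hS hfin w).symm
    have h : IntegrableOn (fun x : Plane => (Real.fourierChar (inner ℝ x w) : ℂ)) S := by
      refine Measure.integrableOn_of_bounded (M := 1) hfin ?_ (Eventually.of_forall fun x => (Circle.norm_coe _).le)
      exact (Continuous.aestronglyMeasurable
        (continuous_induced_dom.comp (Real.continuous_fourierChar.comp (by fun_prop))))
    exact h.integrable_indicator₀ hS
  filter_upwards [Lp.fourierInv_coeFn_ae_eq _ hint] with y hy
  rw [hy, Real.fourierInv_eq, Real.fourierInv_eq]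
  refine integral_congr_ae ?_
  filter_upwards [wave_coeFn hS hfin w] with x hx
  rw [hx]
  by_cases h : x ∈ S
  · simp [h, Circle.smul_def, inner_add_right, AddChar.map_add_eq_mul]
  · simp [h]

/-- Plancherel's identity for the indicator function of `S`. -/
theorem lintegral_fourierInv_indicator_sq :
    ∫⁻ z, ‖𝓕⁻ (S.indicator fun _ => (1 : ℂ)) z‖ₑ ^ 2 = volume S := by
  have h : ‖𝓕⁻ (wave hS hfin 0)‖ₑ ^ 2 = volume S := by
    rw [← enorm_wave_sq hS hfin 0, ← ofReal_norm, ← ofReal_norm]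
    congr 2
    exact (Lp.fourierTransformₗᵢ Plane ℂ).symm.norm_map _
  rw [← h, L2.enorm_sq_eq_lintegral]
  refine lintegral_congr_ae ?_
  filter_upwards [fourierInv_wave_ae_eq hS hfin 0] with y hy
  rw [hy, add_zero]

end Wave

/-! ### The traces of `A` and `A²` -/

section Trace

variable {P R : Set Plane} (hP : NullMeasurableSet P volume) (hR : NullMeasurableSet R volume)
  (hPfin : volume P ≠ ∞) (hRfin : volume R ≠ ∞)
  {ι : Type*} [Countable ι] (b : HilbertBasis ι ℂ L2Plane)

theorem inner_fourierInv_left (f g : L2Plane) : inner ℂ (𝓕⁻ f) g = inner ℂ f (𝓕 g) := by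
  rw [← Lp.inner_fourier_eq, FourierTransform.fourier_fourierInv_eq]

include hPfin in
-- This is `Tr A`: every representer is a wave of squared norm `m(P)`, integrated over `R`.
theorem tsum_enorm_spaceLimit_fourier_spaceLimit_sq :
    ∑' i, ‖spaceLimit R hR (𝓕 (spaceLimit P hP (b i)))‖ₑ ^ 2 = volume P * volume R := by
  rw [tsum_enorm_spaceLimit_sq hR b (fun f => 𝓕 (spaceLimit P hP f)) (wave hP hPfin)
    (fourier_spaceLimit_ae_eq hP hPfin)]
  simp [enorm_wave_sq]

include hRfin in
-- This is `Tr A²`. Moving the operators across the inner product shows that the representer at `x`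
-- is a translate of `K` cut off to `P`.
theorem tsum_enorm_limitingOp_sq :
    ∑' i, ‖spaceLimit P hP (𝓕⁻ (spaceLimit R hR (𝓕 (spaceLimit P hP (b i)))))‖ₑ ^ 2 =
      ∫⁻ x in P, ∫⁻ y in P, ‖𝓕⁻ (R.indicator fun _ => (1 : ℂ)) (y - x)‖ₑ ^ 2 := by
  rw [tsum_enorm_spaceLimit_sq hP b (fun f => 𝓕⁻ (spaceLimit R hR (𝓕 (spaceLimit P hP f))))
    (fun x => spaceLimit P hP (𝓕⁻ (wave hR hRfin (-x)))) fun f => ?_]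
  · refine lintegral_congr fun x => ?_
    rw [enorm_spaceLimit_sq]
    refine lintegral_congr_ae (ae_restrict_of_ae ?_)
    filter_upwards [fourierInv_wave_ae_eq hR hRfin (-x)] with y hy
    rw [hy, sub_eq_add_neg]
  · filter_upwards [fourierInv_spaceLimit_ae_eq hR hRfin (𝓕 (spaceLimit P hP f))] with x hx
    rw [hx, inner_spaceLimit_left, inner_fourierInv_left]

end Trace

/-! ### Dilations and scaling of the kernel integral -/

/-- The diagonal linear map `(x₁, x₂) ↦ (a x₁, b x₂)` of the plane. -/
def dil (a b : ℝ) : Plane →ₗ[ℝ] Plane where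
  toFun x := !₂[a * x 0, b * x 1]
  map_add' x y := by ext i; fin_cases i <;> simp [mul_add]
  map_smul' c x := by ext i; fin_cases i <;> simp [mul_left_comm]

theorem dil_apply (a b : ℝ) (x : Plane) : dil a b x = !₂[a * x 0, b * x 1] := rfl

theorem dil_dil (a b c d : ℝ) (x : Plane) : dil a b (dil c d x) = dil (a * c) (b * d) x := by
  ext i
  fin_cases i <;> simp [dil_apply, mul_assoc]

theorem dil_one_one (x : Plane) : dil 1 1 x = x := by
  ext i
  fin_cases i <;> simp [dil_apply]

theorem det_dil (a b : ℝ) : LinearMap.det (dil a b) = a * b := by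
  rw [← LinearMap.det_toMatrix (EuclideanSpace.basisFun (Fin 2) ℝ).toBasis, Matrix.det_fin_two]
  simp [LinearMap.toMatrix_apply, dil_apply]

theorem inner_dil_left (a b : ℝ) (x y : Plane) : inner ℝ (dil a b x) y = inner ℝ x (dil a b y) := by
  simp [PiLp.inner_apply, dil_apply, Fin.sum_univ_two]
  ring

theorem continuous_dil (a b : ℝ) : Continuous (dil a b) :=
  LinearMap.continuous_of_finiteDimensional _

section Dilation

variable {a b : ℝ} (ha : a ≠ 0) (hb : b ≠ 0)
include ha hb

theorem measurableEmbedding_dil : MeasurableEmbedding (dil a b) :=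
  ((dil a b).equivOfDetNeZero
    (by rw [det_dil]; exact mul_ne_zero ha hb)).toContinuousLinearEquiv.toHomeomorph.measurableEmbedding

theorem map_dil_volume :
    Measure.map (dil a b) volume = ENNReal.ofReal |(a * b)⁻¹| • (volume : Measure Plane) := by
  rw [Measure.map_linearMap_addHaar_eq_smul_addHaar volume (by rw [det_dil]; exact mul_ne_zero ha hb),
    det_dil]

theorem quasiMeasurePreserving_dil :
    Measure.QuasiMeasurePreserving (dil a b) (volume : Measure Plane) volume :=
  ⟨(continuous_dil a b).measurable, by
    rw [map_dil_volume ha hb]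
    exact Measure.smul_absolutelyContinuous⟩

theorem volume_preimage_dil (S : Set Plane) :
    volume (dil a b ⁻¹' S) = ENNReal.ofReal |(a * b)⁻¹| * volume S := by
  rw [Measure.addHaar_preimage_linearMap volume (by rw [det_dil]; exact mul_ne_zero ha hb), det_dil]

theorem lintegral_comp_dil (f : Plane → ℝ≥0∞) :
    ∫⁻ x, f (dil a b x) = ENNReal.ofReal |(a * b)⁻¹| * ∫⁻ x, f x := by
  rw [← (measurableEmbedding_dil ha hb).lintegral_map, map_dil_volume ha hb, lintegral_smul_measure,
    smul_eq_mul]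

theorem integral_comp_dil (f : Plane → ℂ) :
    ∫ x, f (dil a b x) = |(a * b)⁻¹| • ∫ x, f x := by
  rw [← (measurableEmbedding_dil ha hb).integral_map, map_dil_volume ha hb, integral_smul_measure,
    ENNReal.toReal_ofReal (abs_nonneg _)]

theorem image_dil_eq_preimage (S : Set Plane) : dil a b '' S = dil a⁻¹ b⁻¹ ⁻¹' S := by
  refine congrFun (Set.image_eq_preimage_of_inverse (fun x => ?_) fun x => ?_) S
  · rw [dil_dil, inv_mul_cancel₀ ha, inv_mul_cancel₀ hb, dil_one_one]
  · rw [dil_dil, mul_inv_cancel₀ ha, mul_inv_cancel₀ hb, dil_one_one]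

end Dilation

theorem scaleFst_eq_preimage {τ : ℝ} (hτ : τ ≠ 0) (P : Set Plane) :
    scaleFst τ P = dil τ⁻¹ 1 ⁻¹' P := by
  have h := image_dil_eq_preimage hτ one_ne_zero P
  rw [inv_one] at h
  rw [← h]
  refine Set.image_congr' fun x => ?_
  rw [dil_apply, one_mul]

theorem scaleSnd_eq_preimage {ρ : ℝ} (hρ : ρ ≠ 0) (Q : Set Plane) :
    scaleSnd ρ Q = dil 1 ρ⁻¹ ⁻¹' Q := by
  have h := image_dil_eq_preimage one_ne_zero hρ Q
  rw [inv_one] at h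
  rw [← h]
  refine Set.image_congr' fun x => ?_
  rw [dil_apply, one_mul]

theorem ordinaryFreq_eq_preimage (S : Set Plane) :
    ordinaryFreq S = dil (2 * Real.pi) (2 * Real.pi) ⁻¹' S := by
  ext w
  have : dil (2 * Real.pi) (2 * Real.pi) w = (2 * Real.pi) • w := by
    ext i
    fin_cases i <;> simp [dil_apply]
  rw [Set.mem_preimage, this]
  rfl

theorem ordinaryFreq_scaleSnd {ρ : ℝ} (hρ : ρ ≠ 0) (Q : Set Plane) :
    ordinaryFreq (scaleSnd ρ Q) = dil 1 ρ⁻¹ ⁻¹' ordinaryFreq Q := by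
  ext w
  simp only [ordinaryFreq_eq_preimage, scaleSnd_eq_preimage hρ, Set.mem_preimage, dil_dil,
    mul_comm]

theorem volume_scaleFst {τ : ℝ} (hτ : 0 < τ) (P : Set Plane) :
    volume (scaleFst τ P) = ENNReal.ofReal τ * volume P := by
  rw [scaleFst_eq_preimage hτ.ne', volume_preimage_dil (inv_ne_zero hτ.ne') one_ne_zero, mul_one,
    inv_inv, abs_of_pos hτ]

theorem volume_ordinaryFreq_scaleSnd {ρ : ℝ} (hρ : 0 < ρ) (Q : Set Plane) :
    volume (ordinaryFreq (scaleSnd ρ Q)) = ENNReal.ofReal ρ * volume (ordinaryFreq Q) := by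
  rw [ordinaryFreq_scaleSnd hρ.ne', volume_preimage_dil one_ne_zero (inv_ne_zero hρ.ne'), one_mul,
    inv_inv, abs_of_pos hρ]

theorem volume_ordinaryFreq (Q : Set Plane) :
    volume (ordinaryFreq Q) = ENNReal.ofReal ((2 * Real.pi) ^ 2)⁻¹ * volume Q := by
  have h : (2 * Real.pi) ≠ 0 := by positivity
  rw [ordinaryFreq_eq_preimage, volume_preimage_dil h h, ← sq, abs_of_pos (by positivity)]

theorem fourierInv_indicator_preimage_dil {ρ : ℝ} (hρ : 0 < ρ) (R : Set Plane) (z : Plane) :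
    𝓕⁻ ((dil 1 ρ⁻¹ ⁻¹' R).indicator fun _ => (1 : ℂ)) z =
      ρ * 𝓕⁻ (R.indicator fun _ => (1 : ℂ)) (dil 1 ρ z) := by
  rw [Real.fourierInv_eq, Real.fourierInv_eq]
  have h := integral_comp_dil one_ne_zero (inv_ne_zero hρ.ne') fun v =>
    Real.fourierChar (inner ℝ v (dil 1 ρ z)) • R.indicator (fun _ => (1 : ℂ)) v
  rw [one_mul, inv_inv, abs_of_pos hρ, Complex.real_smul] at h
  rw [← h]
  refine integral_congr_ae (Eventually.of_forall fun v => ?_)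
  simp only
  rw [← inner_dil_left, dil_dil, mul_inv_cancel₀ hρ.ne', one_mul, dil_one_one]
  rfl

/-- The kernel integral of the scaled sets, as an integral over the fixed set `P`. -/
theorem lintegral_kernel_preimage_dil {τ ρ : ℝ} (hτ : 0 < τ) (hρ : 0 < ρ) {P : Set Plane}
    (hP : MeasurableSet P) (R : Set Plane) :
    ∫⁻ x in dil τ⁻¹ 1 ⁻¹' P, ∫⁻ y in dil τ⁻¹ 1 ⁻¹' P,
        ‖𝓕⁻ ((dil 1 ρ⁻¹ ⁻¹' R).indicator fun _ => (1 : ℂ)) (y - x)‖ₑ ^ 2 =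
      ENNReal.ofReal (τ * ρ) * ∫⁻ x in P, ∫⁻ z, P.indicator 1 (x + dil τ⁻¹ ρ⁻¹ z) *
        ‖𝓕⁻ (R.indicator fun _ => (1 : ℂ)) z‖ₑ ^ 2 := by
  have hPτ : MeasurableSet (dil τ⁻¹ 1 ⁻¹' P) := (continuous_dil _ _).measurable hP
  set K : Plane → ℂ := 𝓕⁻ (R.indicator fun _ => (1 : ℂ)) with hK
  have h1 : ∀ x, ∫⁻ y in dil τ⁻¹ 1 ⁻¹' P,
      ‖𝓕⁻ ((dil 1 ρ⁻¹ ⁻¹' R).indicator fun _ => (1 : ℂ)) (y - x)‖ₑ ^ 2 =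
      ENNReal.ofReal ρ * ∫⁻ z, P.indicator 1 (dil τ⁻¹ 1 x + dil τ⁻¹ ρ⁻¹ z) * ‖K z‖ₑ ^ 2 := by
    intro x
    -- Translate `y` by `x`, then stretch the second coordinate by `ρ`. The squared kernel gives
    -- `ρ²` and the Jacobian `1/ρ`; the factor `τ` comes later from the `x` integral.
    rw [← lintegral_indicator hPτ, ← lintegral_add_right_eq_self _ x]
    have h2 := lintegral_comp_dil one_ne_zero hρ.ne' fun z =>
      P.indicator 1 (dil τ⁻¹ 1 x + dil τ⁻¹ ρ⁻¹ z) * ‖K z‖ₑ ^ 2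
    have hρ' : ENNReal.ofReal |(1 * ρ)⁻¹| = (ENNReal.ofReal ρ)⁻¹ := by
      rw [one_mul, abs_of_pos (inv_pos.mpr hρ), ENNReal.ofReal_inv_of_pos hρ]
    have h3 : ∫⁻ z, P.indicator 1 (dil τ⁻¹ 1 x + dil τ⁻¹ ρ⁻¹ z) * ‖K z‖ₑ ^ 2 =
        ENNReal.ofReal ρ *
          ∫⁻ z, P.indicator 1 (dil τ⁻¹ 1 x + dil τ⁻¹ ρ⁻¹ (dil 1 ρ z)) * ‖K (dil 1 ρ z)‖ₑ ^ 2 := by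
      rw [h2, hρ', ← mul_assoc, ENNReal.mul_inv_cancel (by simpa using hρ) ENNReal.ofReal_ne_top,
        one_mul]
    rw [h3, ← mul_assoc, ← lintegral_const_mul' _ _
      (ENNReal.mul_ne_top ENNReal.ofReal_ne_top ENNReal.ofReal_ne_top)]
    refine lintegral_congr fun z => ?_
    rw [dil_dil, inv_mul_cancel₀ hρ.ne', mul_one, ← map_add, add_comm x z]
    by_cases h : z + x ∈ dil τ⁻¹ 1 ⁻¹' P
    · have h' : dil τ⁻¹ 1 (z + x) ∈ P := h
      rw [Set.indicator_of_mem h, Set.indicator_of_mem h', add_sub_cancel_right,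
        fourierInv_indicator_preimage_dil hρ, enorm_mul, mul_pow, ← hK, Pi.one_apply, one_mul,
        sq (‖(ρ : ℂ)‖ₑ), ← ofReal_norm (ρ : ℂ), Complex.norm_real, Real.norm_of_nonneg hρ.le]
    · have h' : dil τ⁻¹ 1 (z + x) ∉ P := h
      rw [Set.indicator_of_notMem h, Set.indicator_of_notMem h', zero_mul, mul_zero]
  simp_rw [h1]
  rw [← lintegral_indicator hPτ, ← lintegral_indicator hP]
  have h4 := lintegral_comp_dil (inv_ne_zero hτ.ne') one_ne_zero (P.indicator fun x =>
    ENNReal.ofReal ρ * ∫⁻ z, P.indicator 1 (x + dil τ⁻¹ ρ⁻¹ z) * ‖K z‖ₑ ^ 2)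
  rw [mul_one, inv_inv, abs_of_pos hτ] at h4
  refine Eq.trans h4 ?_
  rw [ENNReal.ofReal_mul hτ.le, mul_assoc]
  congr 1
  rw [← lintegral_const_mul' _ _ ENNReal.ofReal_ne_top]
  refine lintegral_congr fun x => ?_
  by_cases h : x ∈ P <;> simp [h]

/-- Openness of `P` makes the shifted indicator eventually 1 at each `x ∈ P`. Dominated convergence
is used twice: in `z` with majorant `|K|²`, then in `x` with the constant `m(R)` on `P`. -/
theorem tendsto_lintegral_kernel {P R : Set Plane} (hP : IsOpen P) (hPfin : volume P ≠ ∞)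
    (hR : NullMeasurableSet R volume) (hRfin : volume R ≠ ∞) :
    Tendsto (fun p : ℝ × ℝ => ∫⁻ x in P, ∫⁻ z, P.indicator 1 (x + dil p.1⁻¹ p.2⁻¹ z) *
        ‖𝓕⁻ (R.indicator fun _ => (1 : ℂ)) z‖ₑ ^ 2)
      (atTop ×ˢ atTop) (nhds (volume P * volume R)) := by
  set K : Plane → ℂ := 𝓕⁻ (R.indicator fun _ => (1 : ℂ)) with hK
  have hKint : ∫⁻ z, ‖K z‖ₑ ^ 2 = volume R := lintegral_fourierInv_indicator_sq hR hRfin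
  have hKc : Continuous K := by
    refine VectorFourier.fourierIntegral_continuous Real.continuous_fourierChar
      (L := -innerₗ Plane) continuous_inner.neg ?_
    exact IntegrableOn.integrable_indicator₀ (integrableOn_const hRfin) hR
  have hKm : Measurable fun z => ‖K z‖ₑ ^ 2 := hKc.measurable.enorm.pow_const 2
  have hind : Measurable (P.indicator (1 : Plane → ℝ≥0∞)) :=
    measurable_one.indicator hP.measurableSet
  have hjoint : ∀ p : ℝ × ℝ, Measurable fun q : Plane × Plane =>
      P.indicator (1 : Plane → ℝ≥0∞) (q.1 + dil p.1⁻¹ p.2⁻¹ q.2) * ‖K q.2‖ₑ ^ 2 := fun p =>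
    (hind.comp (measurable_fst.add
      ((continuous_dil _ _).measurable.comp measurable_snd))).mul (hKm.comp measurable_snd)
  have hle : ∀ (p : ℝ × ℝ) (x z : Plane),
      P.indicator (1 : Plane → ℝ≥0∞) (x + dil p.1⁻¹ p.2⁻¹ z) * ‖K z‖ₑ ^ 2 ≤ ‖K z‖ₑ ^ 2 := by
    intro p x z
    refine mul_le_of_le_one_left' ?_
    exact Set.indicator_le_self' (by simp) _
  have hdil : ∀ z : Plane, Tendsto (fun p : ℝ × ℝ => dil p.1⁻¹ p.2⁻¹ z) (atTop ×ˢ atTop)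
      (nhds 0) := by
    intro z
    have h1 : Tendsto (fun p : ℝ × ℝ => p.1⁻¹) (atTop ×ˢ atTop) (nhds 0) :=
      tendsto_inv_atTop_zero.comp tendsto_fst
    have h2 : Tendsto (fun p : ℝ × ℝ => p.2⁻¹) (atTop ×ˢ atTop) (nhds 0) :=
      tendsto_inv_atTop_zero.comp tendsto_snd
    have hc : Continuous fun q : ℝ × ℝ => dil q.1 q.2 z := by
      simp only [dil_apply]
      fun_prop
    have h3 := (hc.tendsto (0, 0)).comp (h1.prodMk_nhds h2)
    have h0 : dil 0 0 z = 0 := by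
      ext i
      fin_cases i <;> simp [dil_apply]
    rwa [h0] at h3
  rw [show volume P * volume R = ∫⁻ _ in P, volume R by simp [mul_comm]]
  refine tendsto_lintegral_filter_of_dominated_convergence (fun _ => volume R)
    (Eventually.of_forall fun p => (hjoint p).lintegral_prod_right') (Eventually.of_forall fun p =>
      Eventually.of_forall fun x => ?_) ?_ ?_
  · rw [← hKint]
    exact lintegral_mono fun z => hle p x z
  · simpa using ENNReal.mul_ne_top hRfin hPfin
  · refine (ae_restrict_iff' hP.measurableSet).mpr (Eventually.of_forall fun x hx => ?_)
    rw [← hKint]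
    refine tendsto_lintegral_filter_of_dominated_convergence (fun z => ‖K z‖ₑ ^ 2)
      (Eventually.of_forall fun p => (hjoint p).comp measurable_prodMk_left)
      (Eventually.of_forall fun p => Eventually.of_forall fun z => hle p x z)
      (by rw [hKint]; exact hRfin) (Eventually.of_forall fun z => ?_)
    have h : Tendsto (fun p : ℝ × ℝ => x + dil p.1⁻¹ p.2⁻¹ z) (atTop ×ˢ atTop) (nhds x) := by
      simpa using (hdil z).const_add x
    refine tendsto_const_nhds.congr' ?_
    filter_upwards [h (hP.mem_nhds hx)] with p hp
    have hp' : x + dil p.1⁻¹ p.2⁻¹ z ∈ P := hp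
    simp [hp']

theorem hasSum_norm_sq_of_tsum_enorm_sq {ι E : Type*} [NormedAddCommGroup E] {v : ι → E}
    {c : ℝ≥0∞} (h : ∑' i, ‖v i‖ₑ ^ 2 = c) (hc : c ≠ ∞) :
    HasSum (fun i => ‖v i‖ ^ 2) c.toReal := by
  subst h
  rw [ENNReal.tsum_toReal_eq (ENNReal.ne_top_of_tsum_ne_top hc)]
  simpa using ENNReal.hasSum_toReal hc

/-! ### The operator `A = X* X` and its eigenvalue count -/

section LimitingOp

variable {P Q : Set Plane} (hP : NullMeasurableSet P volume) (hQ : NullMeasurableSet Q volume)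

theorem limitingOp_apply (f : L2Plane) : limitingOp P Q hP hQ f = spaceLimit P hP (𝓕⁻ (spaceLimit
    (ordinaryFreq Q) (nullMeasurableSet_ordinaryFreq hQ) (𝓕 (spaceLimit P hP f)))) := rfl

/-- The factorization `A = X* X`, from which symmetry and positivity follow; it uses that cutoffs
are self-adjoint idempotents and `𝓕` is unitary. -/
theorem inner_limitingOp (f g : L2Plane) :
    inner ℂ f (limitingOp P Q hP hQ g) =
      inner ℂ (spaceLimit (ordinaryFreq Q) (nullMeasurableSet_ordinaryFreq hQ)
          (𝓕 (spaceLimit P hP f)))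
        (spaceLimit (ordinaryFreq Q) (nullMeasurableSet_ordinaryFreq hQ)
          (𝓕 (spaceLimit P hP g))) := by
  rw [limitingOp_apply, ← inner_spaceLimit_left, ← Lp.inner_fourier_eq,
    FourierTransform.fourier_fourierInv_eq, inner_spaceLimit_left, spaceLimit_spaceLimit]

theorem re_inner_limitingOp (f : L2Plane) :
    (inner ℂ f (limitingOp P Q hP hQ f)).re = ‖spaceLimit (ordinaryFreq Q)
      (nullMeasurableSet_ordinaryFreq hQ) (𝓕 (spaceLimit P hP f))‖ ^ 2 := by
  rw [inner_limitingOp]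
  exact inner_self_eq_norm_sq (𝕜 := ℂ) _

theorem isSymmetric_limitingOp :
    (limitingOp P Q hP hQ : L2Plane →ₗ[ℂ] L2Plane).IsSymmetric := by
  intro f g
  change inner ℂ (limitingOp P Q hP hQ f) g = inner ℂ f (limitingOp P Q hP hQ g)
  rw [← inner_conj_symm (limitingOp P Q hP hQ f) g, inner_limitingOp, inner_conj_symm, inner_limitingOp]

theorem norm_limitingOp_le (f : L2Plane) :
    ‖limitingOp P Q hP hQ f‖ ≤ ‖spaceLimit (ordinaryFreq Q)
      (nullMeasurableSet_ordinaryFreq hQ) (𝓕 (spaceLimit P hP f))‖ := by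
  rw [limitingOp_apply]
  refine (norm_spaceLimit_le hP _).trans (le_of_eq ?_)
  exact (Lp.fourierTransformₗᵢ Plane ℂ).symm.norm_map _

variable (hPfin : volume P ≠ ∞) (hQfin : volume Q ≠ ∞)
include hPfin hQfin

/-- `‖A f‖ ≤ ‖X f‖`, and `X` has finite Hilbert–Schmidt norm. -/
theorem isCompactOperator_limitingOp : IsCompactOperator (limitingOp P Q hP hQ) := by
  have : Fact ((2 : ℝ≥0∞) ≠ ∞) := ⟨ENNReal.ofNat_ne_top⟩
  obtain ⟨w, b, -⟩ := exists_hilbertBasis ℂ L2Plane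
  have : Countable w := b.orthonormal.countable_of_separable
  have hRfin : volume (ordinaryFreq Q) ≠ ∞ := by
    rw [volume_ordinaryFreq]
    exact ENNReal.mul_ne_top ENNReal.ofReal_ne_top hQfin
  have h := hasSum_norm_sq_of_tsum_enorm_sq (tsum_enorm_spaceLimit_fourier_spaceLimit_sq hP
    (nullMeasurableSet_ordinaryFreq hQ) hPfin b) (ENNReal.mul_ne_top hPfin hRfin)
  refine ContinuousLinearMap.isCompactOperator_of_summable_norm_sq b _ ?_
  exact h.summable.of_nonneg_of_le (fun i => sq_nonneg _) fun i =>
    pow_le_pow_left₀ (norm_nonneg _) (norm_limitingOp_le hP hQ (b i)) 2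

theorem eigenvalueCount_limitingOp {ε : ℝ} (hε0 : 0 < ε) (hε1 : ε < 1) :
    FinitelyManyEigenvaluesGE (limitingOp P Q hP hQ) ε ∧
      |(eigenvalueCount (limitingOp P Q hP hQ) ε : ℝ) -
          (volume P * volume (ordinaryFreq Q)).toReal| ≤
        (1 / ε + 1 / (1 - ε)) * ((volume P * volume (ordinaryFreq Q)).toReal -
          (∫⁻ x in P, ∫⁻ y in P,
            ‖𝓕⁻ ((ordinaryFreq Q).indicator fun _ => (1 : ℂ)) (y - x)‖ₑ ^ 2).toReal) := by
  have hRfin : volume (ordinaryFreq Q) ≠ ∞ := by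
    rw [volume_ordinaryFreq]
    exact ENNReal.mul_ne_top ENNReal.ofReal_ne_top hQfin
  refine eigenvalueCount_sub_trace_le (isCompactOperator_limitingOp hP hQ hPfin hQfin)
    (isSymmetric_limitingOp hP hQ) (fun x => ?_) (fun x => ?_) (fun ι _ b => ?_) (fun ι _ b => ?_)
    hε0 hε1
  · rw [re_inner_limitingOp]
    positivity
  · rw [re_inner_limitingOp]
    refine pow_le_pow_left₀ (norm_nonneg _) ((norm_spaceLimit_le _ _).trans ?_) 2
    rw [Lp.norm_fourier_eq]
    exact norm_spaceLimit_le _ _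
  · simp_rw [re_inner_limitingOp]
    exact hasSum_norm_sq_of_tsum_enorm_sq (tsum_enorm_spaceLimit_fourier_spaceLimit_sq hP
      (nullMeasurableSet_ordinaryFreq hQ) hPfin b) (ENNReal.mul_ne_top hPfin hRfin)
  · have h := tsum_enorm_limitingOp_sq hP (nullMeasurableSet_ordinaryFreq hQ) hRfin b
    refine hasSum_norm_sq_of_tsum_enorm_sq h ?_
    rw [← h]
    refine ne_top_of_le_ne_top (ENNReal.mul_ne_top hPfin hRfin)
      (le_of_le_of_eq (ENNReal.tsum_le_tsum fun i => ?_)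
        (tsum_enorm_spaceLimit_fourier_spaceLimit_sq hP
          (nullMeasurableSet_ordinaryFreq hQ) hPfin b))
    refine pow_le_pow_left' ?_ 2
    rw [← ofReal_norm, ← ofReal_norm]
    exact ENNReal.ofReal_le_ofReal (norm_limitingOp_le hP hQ (b i))

end LimitingOp

/-! ### Asymptotics -/

/-- The null frontier lets the interior replace `P`, since dilations preserve null sets; the limit
argument needs an open set. -/
theorem lintegral_kernel_scaled {τ ρ : ℝ} (hτ : 0 < τ) (hρ : 0 < ρ) {P : Set Plane}
    (hPbd : volume (frontier P) = 0) (Q : Set Plane) :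
    ∫⁻ x in scaleFst τ P, ∫⁻ y in scaleFst τ P,
        ‖𝓕⁻ ((ordinaryFreq (scaleSnd ρ Q)).indicator fun _ => (1 : ℂ)) (y - x)‖ₑ ^ 2 =
      ENNReal.ofReal (τ * ρ) * ∫⁻ x in interior P, ∫⁻ z,
        (interior P).indicator 1 (x + dil τ⁻¹ ρ⁻¹ z) *
          ‖𝓕⁻ ((ordinaryFreq Q).indicator fun _ => (1 : ℂ)) z‖ₑ ^ 2 := by
  have h : (dil τ⁻¹ 1 ⁻¹' P : Set Plane) =ᵐ[volume] (dil τ⁻¹ 1 ⁻¹' interior P : Set Plane) :=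
    (quasiMeasurePreserving_dil (inv_ne_zero hτ.ne') one_ne_zero).preimage_ae_eq
      (interior_ae_eq_of_null_frontier hPbd).symm
  rw [scaleFst_eq_preimage hτ.ne', ordinaryFreq_scaleSnd hρ.ne', setLIntegral_congr h]
  simp_rw [setLIntegral_congr h]
  exact lintegral_kernel_preimage_dil hτ hρ isOpen_interior.measurableSet _

theorem theorem2 (P Q : Set Plane)
    (hP : NullMeasurableSet P volume) (hQ : NullMeasurableSet Q volume)
    (hPfin : volume P ≠ ∞) (hQfin : volume Q ≠ ∞)
    (hPbd : volume (frontier P) = 0) (hQbd : volume (frontier Q) = 0)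
    (ε : ℝ) (hε0 : 0 < ε) (hε1 : ε < 1) :
    (∀ τ ρ : ℝ, 0 < τ → 0 < ρ →
      FinitelyManyEigenvaluesGE
        (limitingOp (scaleFst τ P) (scaleSnd ρ Q)
          (nullMeasurableSet_scaleFst τ hP) (nullMeasurableSet_scaleSnd ρ hQ)) ε) ∧
    (fun p : ℝ × ℝ =>
        (eigenvalueCount
          (limitingOp (scaleFst p.1 P) (scaleSnd p.2 Q)
            (nullMeasurableSet_scaleFst p.1 hP) (nullMeasurableSet_scaleSnd p.2 hQ)) ε : ℝ)
          - ((2 * Real.pi) ^ 2)⁻¹ * volume.real P * volume.real Q * (p.1 * p.2))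
      =o[atTop ×ˢ atTop] (fun p : ℝ × ℝ => p.1 * p.2) := by
  have hPτ : ∀ τ : ℝ, 0 < τ → volume (scaleFst τ P) ≠ ∞ := fun τ hτ => by
    rw [volume_scaleFst hτ]
    exact ENNReal.mul_ne_top ENNReal.ofReal_ne_top hPfin
  have hQρ : ∀ ρ : ℝ, 0 < ρ → volume (scaleSnd ρ Q) ≠ ∞ := fun ρ hρ => by
    rw [scaleSnd_eq_preimage hρ.ne', volume_preimage_dil one_ne_zero (inv_ne_zero hρ.ne')]
    exact ENNReal.mul_ne_top ENNReal.ofReal_ne_top hQfin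
  have key := fun (τ ρ : ℝ) (hτ : 0 < τ) (hρ : 0 < ρ) =>
    eigenvalueCount_limitingOp (nullMeasurableSet_scaleFst τ hP) (nullMeasurableSet_scaleSnd ρ hQ)
      (hPτ τ hτ) (hQρ ρ hρ) hε0 hε1
  refine ⟨fun τ ρ hτ hρ => (key τ ρ hτ hρ).1, ?_⟩
  have hRfin : volume (ordinaryFreq Q) ≠ ∞ := by
    rw [volume_ordinaryFreq]
    exact ENNReal.mul_ne_top ENNReal.ofReal_ne_top hQfin
  have hint : volume (interior P) = volume P :=
    measure_congr (interior_ae_eq_of_null_frontier hPbd)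
  have hlim := tendsto_lintegral_kernel (P := interior P) isOpen_interior (by rwa [hint])
    (nullMeasurableSet_ordinaryFreq hQ) hRfin
  rw [hint] at hlim
  set J : ℝ × ℝ → ℝ≥0∞ := fun p => ∫⁻ x in interior P, ∫⁻ z,
    (interior P).indicator 1 (x + dil p.1⁻¹ p.2⁻¹ z) *
      ‖𝓕⁻ ((ordinaryFreq Q).indicator fun _ => (1 : ℂ)) z‖ₑ ^ 2 with hJ
  have hVtop : volume P * volume (ordinaryFreq Q) ≠ ∞ := ENNReal.mul_ne_top hPfin hRfin
  have hlimR := (ENNReal.tendsto_toReal hVtop).comp hlim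
  set V : ℝ := (volume P * volume (ordinaryFreq Q)).toReal with hV
  have hVeq : V = ((2 * Real.pi) ^ 2)⁻¹ * volume.real P * volume.real Q := by
    rw [hV, volume_ordinaryFreq, ENNReal.toReal_mul, ENNReal.toReal_mul,
      ENNReal.toReal_ofReal (by positivity), Measure.real, Measure.real]
    ring
  set C : ℝ := 1 / ε + 1 / (1 - ε) with hC
  -- `V - J` is `Tr A - Tr A²` per unit of `τρ`.
  have hsmall : Tendsto (fun p : ℝ × ℝ => C * (V - (J p).toReal)) (atTop ×ˢ atTop) (nhds 0) := by
    simpa using (hlimR.const_sub V).const_mul C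
  have hbound : ∀ᶠ p : ℝ × ℝ in atTop ×ˢ atTop,
      ‖(eigenvalueCount (limitingOp (scaleFst p.1 P) (scaleSnd p.2 Q)
          (nullMeasurableSet_scaleFst p.1 hP) (nullMeasurableSet_scaleSnd p.2 hQ)) ε : ℝ)
        - ((2 * Real.pi) ^ 2)⁻¹ * volume.real P * volume.real Q * (p.1 * p.2)‖ ≤
      ‖C * (V - (J p).toReal) * (p.1 * p.2)‖ := by
    filter_upwards [prod_mem_prod (Ioi_mem_atTop 0) (Ioi_mem_atTop 0)] with p hp
    have hτ : 0 < p.1 := hp.1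
    have hρ : 0 < p.2 := hp.2
    have h := (key p.1 p.2 hτ hρ).2
    have hvol : (volume (scaleFst p.1 P) * volume (ordinaryFreq (scaleSnd p.2 Q))).toReal =
        V * (p.1 * p.2) := by
      rw [volume_scaleFst hτ, volume_ordinaryFreq_scaleSnd hρ, hV]
      simp only [ENNReal.toReal_mul, ENNReal.toReal_ofReal hτ.le, ENNReal.toReal_ofReal hρ.le]
      ring
    rw [lintegral_kernel_scaled hτ hρ hPbd, hvol, ENNReal.toReal_mul,
      ENNReal.toReal_ofReal (mul_pos hτ hρ).le] at h
    rw [← hVeq, Real.norm_eq_abs]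
    refine h.trans (le_trans (le_of_eq ?_) (le_abs_self _))
    ring
  refine (IsBigO.of_bound' hbound).trans_isLittleO ?_
  simpa using ((isLittleO_one_iff ℝ).mpr hsmall).mul_isBigO
    (isBigO_refl (fun p : ℝ × ℝ => p.1 * p.2) (atTop ×ˢ atTop))
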